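/- Let $a,b:[0,\infty)\to[0,\infty)$ be locally integrable and asymptotically periodic: $a=a_1+a_2$, $b=b_1+b_2$, where $a_1(t+T_1)=a_1(t)$, $b_1(t+T_2)=b_1(t)$ for $t\ge 0$ with periods $T_1,T_2>0$, and $a_2(t)\to0$, $b_2(t)\to0$ as $t\to\infty$. Put $$a_m=\frac1{T_1}\int_0^{T_1}a_1(u)\,du,\qquad b_m=\frac1{T_2}\int_0^{T_2}b_1(u)\,du,\qquad \rho=\frac{a_m}{b_m}.$$ Consider the $M_t/M_t/1$ queue, that is, the birth and death process on $\{0,1,2,\dots\}$ with birth rates $\lambda_n(t)=a(t)$ $(n\ge0)$ and death rates $\mu_0(t)=0$, $\mu_n(t)=b(t)$ $(n\ge1)$, and assume that it is underloaded, $0<a_m<b_m$. Let $$\dot\alpha(t)=\bigl(1-\rho^{1/2}\bigr)\bigl(b(t)-\rho^{-1/2}a(t)\bigr).$$ Let $s\ge0$ and let $\mathbf p^1,\mathbf p^2$ be two families of state probabilities on $[s,\infty)$, i.e. functions whose values are probability vectors and which solve the forward Kolmogorov system $$p_0'=-a(t)p_0+b(t)p_1,\qquad p_n'=a(t)p_{n-1}-(a(t)+b(t))p_n+b(t)p_{n+1}\quad(n\ge1)$$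 on $[s,\infty)$ (each $p_i$ is locally absolutely continuous and satisfies its equation for almost every $t\ge s$). Then for every $t\ge s$ $$\sum_{i\ge0}\left|p^1_i(t)-p^2_i(t)\right|\le 4\,e^{-\int_s^t\dot\alpha(u)\,du}\sum_{i\ge1}\left(\sum_{m=0}^{i-1}\rho^{-m/2}\right)\left|p^1_i(s)-p^2_i(s)\right|,$$ where the right-hand side may be $+\infty$. -/

import Mathlib

open MeasureTheory Filter Topology Set

namespace MMQueue

/-- `f = f₁ + f₂` on `[0, ∞)`, where `f₁` is `T`-periodic on `[0, ∞)` and `f₂ → 0` at infinity. -/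
structure IsAsymptoticallyPeriodic (f f₁ f₂ : ℝ → ℝ) (T : ℝ) : Prop where
  period_pos : 0 < T
  decomp : ∀ t, 0 ≤ t → f t = f₁ t + f₂ t
  periodic : ∀ t, 0 ≤ t → f₁ (t + T) = f₁ t
  vanishing : Tendsto f₂ atTop (𝓝 0)

/-- A basic rate function: nonnegative and locally integrable on `[0, ∞)`, and asymptotically
periodic there. -/
structure IsBasicRate (f f₁ f₂ : ℝ → ℝ) (T : ℝ) : Prop where
  nonneg : ∀ t, 0 ≤ t → 0 ≤ f t
  locallyIntegrable : LocallyIntegrableOn f (Ici 0)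
  asymptoticallyPeriodic : IsAsymptoticallyPeriodic f f₁ f₂ T

/-- The mean `(1 / T) ∫₀ᵀ f₁` over a period. -/
noncomputable def periodMean (T : ℝ) (f₁ : ℝ → ℝ) : ℝ :=
  (1 / T) * ∫ u in (0 : ℝ)..T, f₁ u

/-- The vector `A p`, where `A` is the (transposed) intensity matrix of the birth and death
process on `{0, 1, 2, …}` with birth rates `lam n` and death rates `mu n` (no death at `0`). -/
def birthDeathForward (lam mu : ℕ → ℝ) (p : ℕ → ℝ) : ℕ → ℝ
  | 0 => mu 1 * p 1 - lam 0 * p 0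
  | n + 1 => lam n * p n - (lam (n + 1) + mu (n + 1)) * p (n + 1) + mu (n + 2) * p (n + 2)

/-- The set `Ω` of probability vectors on `{0, 1, 2, …}`. -/
def probVectors : Set (ℕ → ℝ) :=
  {x | (∀ i, 0 ≤ x i) ∧ HasSum x 1}

/-- `p` is a family of state probabilities on the time interval `[s, ∞)` of the birth and death
process with birth rates `lam n t` and death rates `mu n t`: a solution with values in `Ω` of the
forward Kolmogorov system `dp/dt = A(t) p`. The rates are only locally integrable, so the system
is understood in the Caratheodory sense: each coordinate is locally absolutely continuous and
satisfies its equation at almost every time. -/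
structure IsStateProbability (lam mu : ℕ → ℝ → ℝ) (s : ℝ) (p : ℝ → ℕ → ℝ) : Prop where
  mem_probVectors : ∀ t, s ≤ t → p t ∈ probVectors
  absolutelyContinuous : ∀ i t, s ≤ t → AbsolutelyContinuousOnInterval (fun u => p u i) s t
  forward : ∀ i, ∀ᵐ t ∂(volume.restrict (Ici s)),
    HasDerivAt (fun u => p u i)
      (birthDeathForward (fun n => lam n t) (fun n => mu n t) (p t) i) t

/-- Birth rates of the `M_t/M_t/1` queue. -/
def arrivalRate (a : ℝ → ℝ) : ℕ → ℝ → ℝ := fun _ t => a t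

/-- Death rates of the `M_t/M_t/1` queue. -/
def serviceRate (b : ℝ → ℝ) : ℕ → ℝ → ℝ := fun n t => if n = 0 then 0 else b t

/-- `α̇(t) = (1 - ρ^{1/2}) (b(t) - ρ^{-1/2} a(t))`. -/
noncomputable def alphaDot (ρ : ℝ) (a b : ℝ → ℝ) (t : ℝ) : ℝ :=
  (1 - ρ ^ (1 / 2 : ℝ)) * (b t - ρ ^ (-(1 / 2) : ℝ) * a t)

/-- The `l₁` distance of two sequences, as an extended nonnegative real. -/
noncomputable def l1Dist (x y : ℕ → ℝ) : ENNReal :=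
  ∑' i : ℕ, ENNReal.ofReal |x i - y i|

/-- The weight `q i = ∑_{m=0}^{i-1} ρ^{-m/2}`. -/
noncomputable def weight (ρ : ℝ) (i : ℕ) : ℝ :=
  ∑ m ∈ Finset.range i, ρ ^ (-(m : ℝ) / 2)

/-- `∑_{i ≥ 1} q i |x i - y i|`, possibly infinite. -/
noncomputable def weightedDist (ρ : ℝ) (x y : ℕ → ℝ) : ENNReal :=
  ∑' i : ℕ, ENNReal.ofReal (weight ρ (i + 1) * |x (i + 1) - y (i + 1)|)

end MMQueue

/-! Let x_k be the difference of the two distribution functions, summed over i < k. Its system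
closes: x_k' = a x_{k-1} - (a+b) x_k + b x_{k+1}, with x_0 = 0. Off-diagonal coefficients are
nonnegative, so w_k = |x_k| satisfies it with ≤ (`isTailSubsolution_abs_cdfDiff`). The sequence q^k
is an eigenvector of the adjoint with eigenvalue a(q-1) + b(1/q-1), which is -α̇ for q = ρ^{-1/2} >
1. Formally, Σ q^k w_k then decays at least like exp(-∫α̇).

A priori this series need not converge after time s, nor be differentiable termwise. `sum_cutoff_le`
therefore tests against the minimum of two backward solutions, one built on q^k and one on L q^{-k}.
Such a minimum is a backward supersolution, and its decay in k kills the flux at infinity because w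
is bounded. A large L recovers any given partial sum (`sum_geom_le`).

The l₁ distance is at most 2 Σ w_k, and Tonelli bounds the initial Σ q^{k-1} w_k by the weighted
distance. The argument gives the constant 2, hence 4. -/

namespace AbsolutelyContinuousOnInterval

/-! ### Calculus of absolutely continuous functions. -/

/-- Postcomposition with a Lipschitz function preserves absolute continuity. -/
theorem lipschitzOn_comp {X Y : Type*} [PseudoMetricSpace X] [PseudoMetricSpace Y]
    {f : ℝ → X} {g : X → Y} {K : NNReal} {s t : ℝ}
    (hf : AbsolutelyContinuousOnInterval f s t) (hg : LipschitzOnWith K g (f '' uIcc s t)) :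
    AbsolutelyContinuousOnInterval (fun u => g (f u)) s t := by
  rw [absolutelyContinuousOnInterval_iff] at hf ⊢
  intro ε hε
  obtain ⟨δ, hδ, h⟩ := hf (ε / (K + 1)) (by positivity)
  refine ⟨δ, hδ, fun E hE hlen => ?_⟩
  have h1 := h E hE hlen
  have hK : (0 : ℝ) < K + 1 := by positivity
  calc ∑ i ∈ Finset.range E.1, dist (g (f (E.2 i).1)) (g (f (E.2 i).2))
      ≤ ∑ i ∈ Finset.range E.1, (K + 1) * dist (f (E.2 i).1) (f (E.2 i).2) := by
        refine Finset.sum_le_sum fun i hi => ?_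
        have hi' := hE.1 i hi
        refine (hg.dist_le_mul _ (mem_image_of_mem f hi'.1) _ (mem_image_of_mem f hi'.2)).trans ?_
        gcongr
        linarith
    _ = (K + 1) * ∑ i ∈ Finset.range E.1, dist (f (E.2 i).1) (f (E.2 i).2) := by
        rw [Finset.mul_sum]
    _ < (K + 1) * (ε / (K + 1)) := by gcongr
    _ = ε := by field_simp

theorem abs {f : ℝ → ℝ} {s t : ℝ} (hf : AbsolutelyContinuousOnInterval f s t) :
    AbsolutelyContinuousOnInterval (fun u => |f u|) s t :=
  hf.lipschitzOn_comp (g := fun x : ℝ => |x|) (K := 1)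
    (LipschitzWith.lipschitzOnWith (by simpa using! lipschitzWith_one_norm (E := ℝ)))

theorem exp {f : ℝ → ℝ} {s t : ℝ} (hf : AbsolutelyContinuousOnInterval f s t) :
    AbsolutelyContinuousOnInterval (fun u => Real.exp (f u)) s t := by
  obtain ⟨C, hC⟩ := hf.exists_bound
  have h : ContDiffOn ℝ 1 Real.exp (Icc (-C) C) := Real.contDiff_exp.contDiffOn
  obtain ⟨K, hK⟩ := h.exists_lipschitzOnWith (by decide) (convex_Icc _ _) isCompact_Icc
  refine hf.lipschitzOn_comp (hK.mono ?_)
  rintro _ ⟨u, hu, rfl⟩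
  exact abs_le.1 (hC u hu)

theorem min {f g : ℝ → ℝ} {s t : ℝ} (hf : AbsolutelyContinuousOnInterval f s t)
    (hg : AbsolutelyContinuousOnInterval g s t) :
    AbsolutelyContinuousOnInterval (fun u => min (f u) (g u)) s t := by
  have h := ((hf.fun_add hg).fun_sub (hf.fun_sub hg).abs).const_mul (1 / 2)
  refine (funext fun u => ?_ : (fun u => Min.min (f u) (g u)) = _) ▸ h
  rcases le_total (f u) (g u) with h | h
  · rw [min_eq_left h, abs_of_nonpos (sub_nonpos.2 h)]
    ring
  · rw [min_eq_right h, abs_of_nonneg (sub_nonneg.2 h)]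
    ring

theorem const (c s t : ℝ) : AbsolutelyContinuousOnInterval (fun _ => c) s t :=
  (LipschitzWith.const c).lipschitzOnWith.absolutelyContinuousOnInterval

theorem fun_sum {ι : Type*} {f : ι → ℝ → ℝ} {s t : ℝ} (I : Finset ι)
    (hf : ∀ i ∈ I, AbsolutelyContinuousOnInterval (f i) s t) :
    AbsolutelyContinuousOnInterval (fun u => ∑ i ∈ I, f i u) s t := by
  classical
  induction I using Finset.induction_on with
  | empty => simpa using const 0 s t
  | insert i I hi ih =>
    simp only [Finset.sum_insert hi]
    exact (hf i (by simp)).fun_add (ih fun j hj => hf j (by simp [hj]))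

theorem sub_le_integral {f g : ℝ → ℝ} {s t : ℝ} (hst : s ≤ t)
    (hf : AbsolutelyContinuousOnInterval f s t) (hg : IntervalIntegrable g volume s t)
    (h : ∀ᵐ u, u ∈ Icc s t → deriv f u ≤ g u) :
    f t - f s ≤ ∫ u in s..t, g u := by
  rw [← hf.integral_deriv_eq_sub]
  exact intervalIntegral.integral_mono_ae_restrict hst hf.intervalIntegrable_deriv hg
    ((ae_restrict_iff' measurableSet_Icc).2 h)

end AbsolutelyContinuousOnInterval

/-! ### Derivatives of minima and absolute values at touching points. -/

/-- A function lying below `g` and touching it at a point has there the same derivative. -/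
theorem deriv_eq_of_le_of_eq {f g : ℝ → ℝ} {g' u : ℝ} (hg : HasDerivAt g g' u)
    (hf : DifferentiableAt ℝ f u) (hle : ∀ v, f v ≤ g v) (heq : f u = g u) : deriv f u = g' := by
  have h1 : HasDerivAt (fun v => g v - f v) (g' - deriv f u) u := hg.sub hf.hasDerivAt
  have h2 : IsLocalMin (fun v => g v - f v) u :=
    Eventually.of_forall fun v => by simpa [heq] using hle v
  linarith [h2.hasDerivAt_eq_zero h1]

/-- If `|f|` and `f` are both differentiable at a point, then `|f|' = sign f * f'` there. -/
theorem deriv_abs_eq_sign_mul {f : ℝ → ℝ} {f' u : ℝ} (hf : HasDerivAt f f' u)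
    (habs : DifferentiableAt ℝ (fun v => |f v|) u) :
    deriv (fun v => |f v|) u = SignType.sign (f u) * f' := by
  rcases lt_trichotomy (f u) 0 with h | h | h
  · have h1 := deriv_eq_of_le_of_eq habs.hasDerivAt hf.neg.differentiableAt
      (fun v => neg_le_abs _) (abs_of_neg h).symm
    have h2 := hf.neg.deriv
    rw [← h1, h2, sign_neg h, SignType.coe_neg_one, neg_one_mul]
  · have h1 : IsLocalMin (fun v => |f v|) u :=
      Eventually.of_forall fun v => by simp [h]
    rw [h1.deriv_eq_zero, h, sign_zero, SignType.coe_zero, zero_mul]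
  · have h1 := deriv_eq_of_le_of_eq habs.hasDerivAt hf.differentiableAt
      (fun v => le_abs_self _) (abs_of_pos h).symm
    rw [← h1, hf.deriv, sign_pos h, SignType.coe_one, one_mul]

/-! ### Weighted comparison for tail subsolutions. -/

namespace MMQueue

theorem sum_range_birthDeath_by_parts (a b : ℝ) (D w : ℕ → ℝ) (n : ℕ) :
    ∑ j ∈ Finset.range n, D (j + 1) * (a * w j - (a + b) * w (j + 1) + b * w (j + 2)) =
      ∑ j ∈ Finset.range n, (a * D (j + 2) - (a + b) * D (j + 1) + b * D j) * w (j + 1) +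
        a * D 1 * w 0 - a * D (n + 1) * w n + b * D n * w (n + 1) - b * D 0 * w 1 := by
  induction n with
  | zero => simp
  | succ n ih =>
    rw [Finset.sum_range_succ, ih, Finset.sum_range_succ]
    ring

/-- The rate `a (x - 1) + b (x⁻¹ - 1)` for which `x ^ k` is an eigenvector of the adjoint of the
tail system. -/
noncomputable def geomRate (a b : ℝ → ℝ) (x u : ℝ) : ℝ :=
  a u * (x - 1) + b u * (x⁻¹ - 1)

/-- The geometric solution of the backward system started at time `s`. -/
noncomputable def geomWeight (a b : ℝ → ℝ) (s x u : ℝ) (k : ℕ) : ℝ :=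
  Real.exp (-∫ v in s..u, geomRate a b x v) * x ^ k

section Comparison

variable {a b : ℝ → ℝ} {s t : ℝ}

theorem intervalIntegrable_geomRate (ha : IntervalIntegrable a volume s t)
    (hb : IntervalIntegrable b volume s t) (x : ℝ) :
    IntervalIntegrable (geomRate a b x) volume s t :=
  (ha.mul_const _).add (hb.mul_const _)

theorem geomWeight_absolutelyContinuous (ha : IntervalIntegrable a volume s t)
    (hb : IntervalIntegrable b volume s t) (x : ℝ) (k : ℕ) :
    AbsolutelyContinuousOnInterval (fun u => geomWeight a b s x u k) s t := by
  have h := (intervalIntegrable_geomRate ha hb x).absolutelyContinuousOnInterval_intervalIntegral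
    (c := s) (by simp)
  exact h.fun_neg.exp.fun_mul (.const _ s t)

theorem ae_hasDerivAt_geomWeight (hst : s ≤ t) (ha : IntervalIntegrable a volume s t)
    (hb : IntervalIntegrable b volume s t) (x : ℝ) :
    ∀ᵐ u, u ∈ Icc s t → ∀ k, HasDerivAt (fun v => geomWeight a b s x v k)
      (-geomRate a b x u * geomWeight a b s x u k) u := by
  filter_upwards [(intervalIntegrable_geomRate ha hb x).ae_hasDerivAt_integral] with u hu hmem k
  have h := hu (by rwa [uIcc_of_le hst]) s (by simp)
  refine (h.fun_neg.exp.mul_const (x ^ k)).congr_deriv ?_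
  unfold geomWeight
  ring

theorem geomWeight_backward {x : ℝ} (hx : x ≠ 0) (u : ℝ) (k : ℕ) :
    -geomRate a b x u * geomWeight a b s x u (k + 1) + (a u * geomWeight a b s x u (k + 2)
      - (a u + b u) * geomWeight a b s x u (k + 1) + b u * geomWeight a b s x u k) = 0 := by
  simp only [geomWeight, geomRate]
  field_simp
  ring

theorem geomWeight_pos {x : ℝ} (hx : 0 < x) (u : ℝ) (k : ℕ) : 0 < geomWeight a b s x u k := by
  unfold geomWeight
  positivity

/-- The minimum of two positive solutions of the backward system. -/
noncomputable def cutoffWeight (a b : ℝ → ℝ) (s q L u : ℝ) (k : ℕ) : ℝ :=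
  min (geomWeight a b s q u k) (L * geomWeight a b s q⁻¹ u k)

/-- Here δ is the derivative of the branch active at index k+1; touching transfers it to the product
with w. At the neighbours k and k+2 the minimum lies below that branch, and a, b ≥ 0, so the
branch's backward equation becomes an inequality. -/
theorem exists_deriv_cutoffWeight_mul {q L u : ℝ} (hq : 0 < q)
    (hau : 0 ≤ a u) (hbu : 0 ≤ b u) {k : ℕ} {w : ℝ → ℝ} {w' : ℝ}
    (hw : ∀ v, 0 ≤ w v) (hw' : HasDerivAt w w' u)
    (hX : HasDerivAt (fun v => geomWeight a b s q v (k + 1))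
      (-geomRate a b q u * geomWeight a b s q u (k + 1)) u)
    (hY : HasDerivAt (fun v => geomWeight a b s q⁻¹ v (k + 1))
      (-geomRate a b q⁻¹ u * geomWeight a b s q⁻¹ u (k + 1)) u)
    (hG : DifferentiableAt ℝ (fun v => cutoffWeight a b s q L v (k + 1) * w v) u) :
    ∃ δ : ℝ, deriv (fun v => cutoffWeight a b s q L v (k + 1) * w v) u =
        δ * w u + cutoffWeight a b s q L u (k + 1) * w' ∧
      δ + (a u * cutoffWeight a b s q L u (k + 2)
        - (a u + b u) * cutoffWeight a b s q L u (k + 1)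
        + b u * cutoffWeight a b s q L u k) ≤ 0 := by
  rcases le_total (geomWeight a b s q u (k + 1)) (L * geomWeight a b s q⁻¹ u (k + 1)) with h | h
  · refine ⟨-geomRate a b q u * geomWeight a b s q u (k + 1),
      (deriv_eq_of_le_of_eq (hX.fun_mul hw') hG
      (fun v => mul_le_mul_of_nonneg_right (min_le_left _ _) (hw v)) ?_).trans ?_, ?_⟩
    · simp only [cutoffWeight, min_eq_left h]
    · rw [cutoffWeight, min_eq_left h]
    · have h1 := geomWeight_backward (a := a) (b := b) (s := s) hq.ne' u k
      have h2 := mul_le_mul_of_nonneg_left (min_le_left (geomWeight a b s q u (k + 2))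
        (L * geomWeight a b s q⁻¹ u (k + 2))) hau
      have h3 := mul_le_mul_of_nonneg_left (min_le_left (geomWeight a b s q u k)
        (L * geomWeight a b s q⁻¹ u k)) hbu
      have h4 : cutoffWeight a b s q L u (k + 1) = _ := min_eq_left h
      rw [h4]
      unfold cutoffWeight
      linarith
  · refine ⟨L * (-geomRate a b q⁻¹ u * geomWeight a b s q⁻¹ u (k + 1)),
      (deriv_eq_of_le_of_eq ((hY.const_mul L).fun_mul hw') hG
      (fun v => mul_le_mul_of_nonneg_right (min_le_right _ _) (hw v)) ?_).trans ?_, ?_⟩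
    · simp only [cutoffWeight, min_eq_right h]
    · rw [cutoffWeight, min_eq_right h]
    · have h1 := geomWeight_backward (a := a) (b := b) (s := s) (inv_pos.2 hq).ne' u k
      have h2 := mul_le_mul_of_nonneg_left (min_le_right (geomWeight a b s q u (k + 2))
        (L * geomWeight a b s q⁻¹ u (k + 2))) hau
      have h3 := mul_le_mul_of_nonneg_left (min_le_right (geomWeight a b s q u k)
        (L * geomWeight a b s q⁻¹ u k)) hbu
      have h4 : cutoffWeight a b s q L u (k + 1) = _ := min_eq_right h
      rw [h4]
      unfold cutoffWeight
      linear_combination L * h1 + h2 + h3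

/-- A bounded nonnegative subsolution of the tail system, with zero boundary value. -/
structure IsTailSubsolution (a b : ℝ → ℝ) (s t : ℝ) (w : ℕ → ℝ → ℝ) : Prop where
  nonneg : ∀ k u, 0 ≤ w k u
  zero : ∀ u, w 0 u = 0
  bounded : ∃ C, ∀ k, ∀ u ∈ Icc s t, w k u ≤ C
  absolutelyContinuous : ∀ k, AbsolutelyContinuousOnInterval (w k) s t
  deriv_le : ∀ᵐ u, u ∈ Icc s t → ∀ j, deriv (w (j + 1)) u ≤
    a u * w j u - (a u + b u) * w (j + 1) u + b u * w (j + 2) u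

variable {w : ℕ → ℝ → ℝ}

theorem cutoffWeight_pos {q L : ℝ} (hq : 0 < q) (hL : 0 < L) (u : ℝ) (k : ℕ) :
    0 < cutoffWeight a b s q L u k :=
  lt_min (geomWeight_pos hq u k) (mul_pos hL (geomWeight_pos (inv_pos.2 hq) u k))

theorem IsTailSubsolution.cutoff_absolutelyContinuous (hw : IsTailSubsolution a b s t w)
    (ha : IntervalIntegrable a volume s t) (hb : IntervalIntegrable b volume s t)
    (q L : ℝ) (k : ℕ) :
    AbsolutelyContinuousOnInterval (fun u => cutoffWeight a b s q L u k * w k u) s t :=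
  ((geomWeight_absolutelyContinuous ha hb q k).min
    ((geomWeight_absolutelyContinuous ha hb q⁻¹ k).const_mul L)).fun_mul
      (hw.absolutelyContinuous k)

/-- After summation by parts the interior terms cancel with the right sign. Of the boundary terms,
only the inflow from level n+1 can be positive. -/
theorem IsTailSubsolution.deriv_sum_cutoff_le (hw : IsTailSubsolution a b s t w) (hst : s ≤ t)
    (ha : IntervalIntegrable a volume s t) (hb : IntervalIntegrable b volume s t)
    (ha0 : ∀ u ∈ Icc s t, 0 ≤ a u) (hb0 : ∀ u ∈ Icc s t, 0 ≤ b u)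
    {q L : ℝ} (hq : 0 < q) (hL : 0 < L) (n : ℕ) :
    ∀ᵐ u, u ∈ Icc s t →
      deriv (fun v => ∑ j ∈ Finset.range n, cutoffWeight a b s q L v (j + 1) * w (j + 1) v) u ≤
        b u * cutoffWeight a b s q L u n * w (n + 1) u := by
  have hdw : ∀ᵐ u, ∀ j, u ∈ uIcc s t → DifferentiableAt ℝ (w j) u :=
    ae_all_iff.2 fun j => (hw.absolutelyContinuous j).ae_differentiableAt
  have hdG : ∀ᵐ u, ∀ j, u ∈ uIcc s t →
      DifferentiableAt ℝ (fun v => cutoffWeight a b s q L v j * w j v) u :=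
    ae_all_iff.2 fun j => (hw.cutoff_absolutelyContinuous ha hb q L j).ae_differentiableAt
  filter_upwards [hdw, hdG, hw.deriv_le, ae_hasDerivAt_geomWeight hst ha hb q,
    ae_hasDerivAt_geomWeight hst ha hb q⁻¹] with u h1 h2 h3 h4 h5 hu
  have hu' : u ∈ uIcc s t := by rwa [uIcc_of_le hst]
  rw [deriv_fun_sum fun j _ => h2 (j + 1) hu']
  set D := cutoffWeight a b s q L u with hD
  have hDpos : ∀ k, 0 < D k := fun k => cutoffWeight_pos hq hL u k
  calc ∑ j ∈ Finset.range n, deriv (fun v => cutoffWeight a b s q L v (j + 1) * w (j + 1) v) u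
      ≤ ∑ j ∈ Finset.range n,
          (D (j + 1) * (a u * w j u - (a u + b u) * w (j + 1) u + b u * w (j + 2) u) -
          (a u * D (j + 2) - (a u + b u) * D (j + 1) + b u * D j) * w (j + 1) u) := by
        refine Finset.sum_le_sum fun j _ => ?_
        obtain ⟨δ, hδ, hle⟩ := exists_deriv_cutoffWeight_mul (L := L) hq (ha0 u hu) (hb0 u hu)
          (hw.nonneg (j + 1)) (h1 (j + 1) hu').hasDerivAt (h4 hu (j + 1)) (h5 hu (j + 1))
          (h2 (j + 1) hu')
        rw [hδ]
        have e1 := mul_le_mul_of_nonneg_left (h3 hu j) (hDpos (j + 1)).le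
        have e2 := mul_le_mul_of_nonneg_right hle (hw.nonneg (j + 1) u)
        rw [← hD] at *
        linarith
    _ = a u * D 1 * w 0 u - a u * D (n + 1) * w n u + b u * D n * w (n + 1) u
          - b u * D 0 * w 1 u := by
        rw [Finset.sum_sub_distrib,
          sum_range_birthDeath_by_parts (a u) (b u) D (fun k => w k u) n]
        ring
    _ ≤ b u * D n * w (n + 1) u := by
        have e1 := mul_nonneg (mul_nonneg (ha0 u hu) (hDpos (n + 1)).le) (hw.nonneg n u)
        have e2 := mul_nonneg (mul_nonneg (hb0 u hu) (hDpos 0).le) (hw.nonneg 1 u)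
        rw [hw.zero]
        linarith

theorem IsTailSubsolution.sum_cutoff_le (hw : IsTailSubsolution a b s t w) (hst : s ≤ t)
    (ha : IntervalIntegrable a volume s t) (hb : IntervalIntegrable b volume s t)
    (ha0 : ∀ u ∈ Icc s t, 0 ≤ a u) (hb0 : ∀ u ∈ Icc s t, 0 ≤ b u)
    {q L N : ℝ} (hq : 1 < q) (hL : 0 < L)
    (hN : ∀ n, ∑ j ∈ Finset.range n, q ^ (j + 1) * w (j + 1) s ≤ N) (K : ℕ) :
    ∑ j ∈ Finset.range K, cutoffWeight a b s q L t (j + 1) * w (j + 1) t ≤ N := by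
  have hq0 : 0 < q := by linarith
  obtain ⟨C, hC⟩ := hw.bounded
  -- At index 0 the weight is its exponential factor alone, so M bounds that factor on the whole
  -- interval.
  obtain ⟨M, hM⟩ := (geomWeight_absolutelyContinuous ha hb q⁻¹ 0).exists_bound
  -- K stays fixed while the truncation level n tends to infinity; the error is of order q^{-n}.
  have key : ∀ n, K ≤ n →
      ∑ j ∈ Finset.range K, cutoffWeight a b s q L t (j + 1) * w (j + 1) t ≤
        N + (∫ u in s..t, b u) * (L * M * C) * q⁻¹ ^ n := by
    intro n hn
    have hG := AbsolutelyContinuousOnInterval.fun_sum (Finset.range n)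
      fun j _ => hw.cutoff_absolutelyContinuous ha hb q L (j + 1)
    have h1 := hG.sub_le_integral (g := fun u => b u * (L * M * C * q⁻¹ ^ n)) hst
      (hb.mul_const _) (by
        filter_upwards [hw.deriv_sum_cutoff_le hst ha hb ha0 hb0 hq0 hL n] with u h hu
        refine (h hu).trans ?_
        rw [mul_assoc]
        refine mul_le_mul_of_nonneg_left ?_ (hb0 u hu)
        have e1 : cutoffWeight a b s q L u n ≤ L * M * q⁻¹ ^ n := by
          refine (min_le_right _ _).trans ?_
          have e2 := (le_abs_self _).trans (hM u (by rwa [uIcc_of_le hst]))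
          simp only [geomWeight, pow_zero, mul_one] at e2 ⊢
          rw [mul_assoc]
          gcongr
        calc cutoffWeight a b s q L u n * w (n + 1) u
            ≤ L * M * q⁻¹ ^ n * C :=
              mul_le_mul e1 (hC _ u hu) (hw.nonneg _ _) ((cutoffWeight_pos hq0 hL u n).le.trans e1)
          _ = _ := by ring)
    rw [intervalIntegral.integral_mul_const] at h1
    have h2 : ∑ j ∈ Finset.range n, cutoffWeight a b s q L s (j + 1) * w (j + 1) s ≤ N := by
      refine (Finset.sum_le_sum fun j _ => ?_).trans (hN n)
      refine mul_le_mul_of_nonneg_right ((min_le_left _ _).trans_eq ?_) (hw.nonneg _ _)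
      simp [geomWeight]
    have h3 : ∑ j ∈ Finset.range K, cutoffWeight a b s q L t (j + 1) * w (j + 1) t ≤
        ∑ j ∈ Finset.range n, cutoffWeight a b s q L t (j + 1) * w (j + 1) t :=
      Finset.sum_le_sum_of_subset_of_nonneg (Finset.range_mono hn)
        fun j _ _ => mul_nonneg (cutoffWeight_pos hq0 hL t _).le (hw.nonneg _ _)
    linarith
  have hlim : Tendsto (fun n : ℕ => N + (∫ u in s..t, b u) * (L * M * C) * q⁻¹ ^ n) atTop
      (𝓝 (N + (∫ u in s..t, b u) * (L * M * C) * 0)) :=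
    ((tendsto_pow_atTop_nhds_zero_of_lt_one (inv_pos.2 hq0).le (inv_lt_one_of_one_lt₀ hq)).const_mul
      _).const_add _
  rw [mul_zero, add_zero] at hlim
  exact ge_of_tendsto hlim (eventually_atTop.2 ⟨K, key⟩)

/-- The weighted sum `∑ q ^ k w k` of a tail subsolution grows at most like
`exp (∫ (a (q - 1) + b (q⁻¹ - 1)))`. -/
theorem IsTailSubsolution.sum_geom_le (hw : IsTailSubsolution a b s t w) (hst : s ≤ t)
    (ha : IntervalIntegrable a volume s t) (hb : IntervalIntegrable b volume s t)
    (ha0 : ∀ u ∈ Icc s t, 0 ≤ a u) (hb0 : ∀ u ∈ Icc s t, 0 ≤ b u)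
    {q N : ℝ} (hq : 1 < q)
    (hN : ∀ n, ∑ j ∈ Finset.range n, q ^ (j + 1) * w (j + 1) s ≤ N) (K : ℕ) :
    ∑ j ∈ Finset.range K, q ^ (j + 1) * w (j + 1) t ≤
      Real.exp (∫ u in s..t, geomRate a b q u) * N := by
  have hq0 : 0 < q := by linarith
  set X := geomWeight a b s q t 0 with hX
  set Y := geomWeight a b s q⁻¹ t 0 with hY
  have hX0 : 0 < X := geomWeight_pos hq0 t 0
  have hY0 : 0 < Y := geomWeight_pos (inv_pos.2 hq0) t 0
  -- This L makes the q^k branch the smaller one at time t for every index k ≤ K, since q^k ≤ q^{2K}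
  -- q^{-k}.
  have h := hw.sum_cutoff_le hst ha hb ha0 hb0 (L := X / Y * q ^ (2 * K)) hq (by positivity) hN K
  have h1 : ∑ j ∈ Finset.range K, cutoffWeight a b s q (X / Y * q ^ (2 * K)) t (j + 1) *
      w (j + 1) t = X * ∑ j ∈ Finset.range K, q ^ (j + 1) * w (j + 1) t := by
    rw [Finset.mul_sum]
    refine Finset.sum_congr rfl fun j hj => ?_
    have hjK : j + 1 ≤ K := Finset.mem_range.1 hj
    have eX : ∀ k, geomWeight a b s q t k = X * q ^ k := fun k => by simp [hX, geomWeight]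
    have eY : ∀ k, geomWeight a b s q⁻¹ t k = Y * q⁻¹ ^ k := fun k => by simp [hY, geomWeight]
    rw [cutoffWeight, eX, eY, min_eq_left, mul_assoc]
    have e1 : q ^ (j + 1) ≤ q ^ (2 * K) * q⁻¹ ^ (j + 1) := by
      rw [inv_pow, ← div_eq_mul_inv, le_div_iff₀ (by positivity), ← pow_add]
      exact pow_le_pow_right₀ hq.le (by omega)
    calc X * q ^ (j + 1) ≤ X * (q ^ (2 * K) * q⁻¹ ^ (j + 1)) := by gcongr
      _ = X / Y * q ^ (2 * K) * (Y * q⁻¹ ^ (j + 1)) := by field_simp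
  rw [h1] at h
  have h2 : Real.exp (∫ u in s..t, geomRate a b q u) * X = 1 := by
    rw [hX, geomWeight, pow_zero, mul_one, ← Real.exp_add, add_neg_cancel, Real.exp_zero]
  calc ∑ j ∈ Finset.range K, q ^ (j + 1) * w (j + 1) t
      = Real.exp (∫ u in s..t, geomRate a b q u) *
          (X * ∑ j ∈ Finset.range K, q ^ (j + 1) * w (j + 1) t) := by
        rw [← mul_assoc, h2, one_mul]
    _ ≤ _ := by gcongr

end Comparison

/-! ### The distribution functions and their system. -/

theorem sum_range_birthDeathForward (lam mu p : ℕ → ℝ) (k : ℕ) :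
    ∑ i ∈ Finset.range (k + 1), birthDeathForward lam mu p i =
      mu (k + 1) * p (k + 1) - lam k * p k := by
  induction k with
  | zero => simp [birthDeathForward]
  | succ k ih =>
    rw [Finset.sum_range_succ, ih, birthDeathForward]
    ring

theorem sum_range_mem_Icc_of_mem_probVectors {x : ℕ → ℝ} (hx : x ∈ probVectors) (k : ℕ) :
    ∑ i ∈ Finset.range k, x i ∈ Icc (0 : ℝ) 1 :=
  ⟨Finset.sum_nonneg fun i _ => hx.1 i, sum_le_hasSum _ (fun i _ => hx.1 i) hx.2⟩

/-- The difference of the distribution functions of `x` and `y`. -/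
def cdfDiff (x y : ℕ → ℝ) (k : ℕ) : ℝ :=
  ∑ i ∈ Finset.range k, (x i - y i)

theorem cdfDiff_succ (x y : ℕ → ℝ) (k : ℕ) :
    cdfDiff x y (k + 1) = cdfDiff x y k + (x k - y k) :=
  Finset.sum_range_succ _ _

theorem abs_cdfDiff_le_one {x y : ℕ → ℝ} (hx : x ∈ probVectors) (hy : y ∈ probVectors) (k : ℕ) :
    |cdfDiff x y k| ≤ 1 := by
  have h1 := sum_range_mem_Icc_of_mem_probVectors hx k
  have h2 := sum_range_mem_Icc_of_mem_probVectors hy k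
  rw [cdfDiff, Finset.sum_sub_distrib, abs_le]
  constructor <;> linarith [h1.1, h1.2, h2.1, h2.2]

theorem ae_hasDerivAt_cdfDiff {a b : ℝ → ℝ} {s : ℝ} {p₁ p₂ : ℝ → ℕ → ℝ}
    (hp₁ : IsStateProbability (arrivalRate a) (serviceRate b) s p₁)
    (hp₂ : IsStateProbability (arrivalRate a) (serviceRate b) s p₂) :
    ∀ᵐ u, s ≤ u → ∀ k, HasDerivAt (fun v => cdfDiff (p₁ v) (p₂ v) (k + 1))
      (b u * (cdfDiff (p₁ u) (p₂ u) (k + 2) - cdfDiff (p₁ u) (p₂ u) (k + 1)) -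
        a u * (cdfDiff (p₁ u) (p₂ u) (k + 1) - cdfDiff (p₁ u) (p₂ u) k)) u := by
  filter_upwards [(ae_restrict_iff' measurableSet_Ici).1 (ae_all_iff.2 hp₁.forward),
    (ae_restrict_iff' measurableSet_Ici).1 (ae_all_iff.2 hp₂.forward)] with u h1 h2 hu k
  have h := HasDerivAt.fun_sum (u := Finset.range (k + 1))
    fun i _ => (h1 hu i).fun_sub (h2 hu i)
  rw [Finset.sum_sub_distrib, sum_range_birthDeathForward, sum_range_birthDeathForward] at h
  refine h.congr_deriv ?_
  simp only [cdfDiff_succ, arrivalRate, serviceRate]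
  simp
  ring

/-- Multiply the equation for x_k by sign x_k: the diagonal term gives |x_k| exactly, and the
neighbours contribute at most their absolute values. -/
theorem isTailSubsolution_abs_cdfDiff {a b : ℝ → ℝ} {s t : ℝ} (hst : s ≤ t)
    (ha0 : ∀ u ∈ Icc s t, 0 ≤ a u) (hb0 : ∀ u ∈ Icc s t, 0 ≤ b u) {p₁ p₂ : ℝ → ℕ → ℝ}
    (hp₁ : IsStateProbability (arrivalRate a) (serviceRate b) s p₁)
    (hp₂ : IsStateProbability (arrivalRate a) (serviceRate b) s p₂) :
    IsTailSubsolution a b s t fun k u => |cdfDiff (p₁ u) (p₂ u) k| where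
  nonneg _ _ := abs_nonneg _
  zero _ := by simp [cdfDiff]
  bounded := ⟨1, fun k u hu =>
    abs_cdfDiff_le_one (hp₁.mem_probVectors u hu.1) (hp₂.mem_probVectors u hu.1) k⟩
  absolutelyContinuous k := (AbsolutelyContinuousOnInterval.fun_sum _ fun i _ =>
    (hp₁.absolutelyContinuous i t hst).fun_sub (hp₂.absolutelyContinuous i t hst)).abs
  deriv_le := by
    have hd : ∀ᵐ u, ∀ k, u ∈ uIcc s t →
        DifferentiableAt ℝ (fun v => |cdfDiff (p₁ v) (p₂ v) k|) u :=
      ae_all_iff.2 fun k => (AbsolutelyContinuousOnInterval.fun_sum (Finset.range k) fun i _ =>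
        (hp₁.absolutelyContinuous i t hst).fun_sub
          (hp₂.absolutelyContinuous i t hst)).abs.ae_differentiableAt
    filter_upwards [ae_hasDerivAt_cdfDiff hp₁ hp₂, hd] with u h1 h2 hu j
    rw [deriv_abs_eq_sign_mul (h1 hu.1 j) (h2 (j + 1) (by rwa [uIcc_of_le hst]))]
    set x := cdfDiff (p₁ u) (p₂ u)
    set σ : ℝ := ((SignType.sign (x (j + 1)) : SignType) : ℝ) with hσ
    have hle : ∀ y : ℝ, σ * y ≤ |y| := fun y => by
      refine (le_abs_self _).trans ?_
      rw [abs_mul]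
      refine mul_le_of_le_one_left (abs_nonneg y) ?_
      rw [hσ]
      cases SignType.sign (x (j + 1)) <;> simp
    have heq : σ * x (j + 1) = |x (j + 1)| := sign_mul_self _
    have e1 := mul_le_mul_of_nonneg_left (hle (x j)) (ha0 u hu)
    have e2 := mul_le_mul_of_nonneg_left (hle (x (j + 2))) (hb0 u hu)
    linear_combination e1 + e2 - (a u + b u) * heq

/-! ### Comparison of the distances. -/

/-- Both vectors have total mass 1, so the partial sum of the difference is minus its tail. -/
theorem ofReal_abs_cdfDiff_le {x y : ℕ → ℝ} (hx : x ∈ probVectors) (hy : y ∈ probVectors)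
    (k : ℕ) :
    ENNReal.ofReal |cdfDiff x y k| ≤ ∑' i, ENNReal.ofReal |x (i + k) - y (i + k)| := by
  have hz : HasSum (fun i => x i - y i) 0 := by
    have h := hx.2.sub hy.2
    rwa [sub_self] at h
  have h := hz.summable.sum_add_tsum_nat_add k
  rw [hz.tsum_eq] at h
  have habs : Summable fun i => |x (i + k) - y (i + k)| :=
    ((summable_nat_add_iff k).2 hz.summable).abs
  rw [← ENNReal.ofReal_tsum_of_nonneg (fun _ => abs_nonneg _) habs]
  refine ENNReal.ofReal_le_ofReal ?_
  rw [cdfDiff, eq_neg_of_add_eq_zero_left h, abs_neg]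
  exact norm_tsum_le_tsum_norm (f := fun i => x (i + k) - y (i + k)) habs

theorem l1Dist_le_two_mul_tsum_abs_cdfDiff (x y : ℕ → ℝ) :
    l1Dist x y ≤ 2 * ∑' j, ENNReal.ofReal |cdfDiff x y (j + 1)| := by
  have h0 : ∑' j, ENNReal.ofReal |cdfDiff x y j| = ∑' j, ENNReal.ofReal |cdfDiff x y (j + 1)| := by
    rw [tsum_eq_zero_add' ENNReal.summable]
    simp [cdfDiff]
  calc l1Dist x y
      ≤ ∑' j, (ENNReal.ofReal |cdfDiff x y (j + 1)| + ENNReal.ofReal |cdfDiff x y j|) := by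
        refine ENNReal.tsum_le_tsum fun j => ?_
        rw [← ENNReal.ofReal_add (abs_nonneg _) (abs_nonneg _)]
        refine ENNReal.ofReal_le_ofReal ?_
        rw [show x j - y j = cdfDiff x y (j + 1) - cdfDiff x y j by rw [cdfDiff_succ]; ring]
        exact abs_sub _ _
    _ = _ := by rw [ENNReal.tsum_add, h0, two_mul]

/-- Tonelli: f i is counted once with factor c j for each j ≤ i. With c j = q^j this produces the
weights. -/
theorem tsum_mul_tsum_nat_add (c f : ℕ → ENNReal) :
    ∑' j, c j * ∑' i, f (i + j) = ∑' i, (∑ j ∈ Finset.range (i + 1), c j) * f i := by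
  have h1 : ∀ j, ∑' i, f (i + j) = ∑' i, if j ≤ i then f i else 0 := fun j => by
    rw [← ENNReal.summable.sum_add_tsum_nat_add' (f := fun i => if j ≤ i then f i else 0) (k := j),
      Finset.sum_eq_zero fun i hi => if_neg (not_le.2 (Finset.mem_range.1 hi))]
    simp
  simp_rw [h1, ← ENNReal.tsum_mul_left]
  rw [ENNReal.tsum_comm]
  refine tsum_congr fun i => ?_
  rw [Finset.sum_mul, tsum_eq_sum (s := Finset.range (i + 1))
    fun j hj => by rw [if_neg (by simpa [Nat.lt_succ_iff] using hj), mul_zero]]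
  exact Finset.sum_congr rfl fun j hj =>
    by rw [if_pos (Nat.lt_succ_iff.1 (Finset.mem_range.1 hj))]

theorem weight_eq_sum_pow {ρ : ℝ} (hρ : 0 < ρ) (i : ℕ) :
    weight ρ i = ∑ m ∈ Finset.range i, (ρ ^ (-(1 / 2) : ℝ)) ^ m := by
  refine Finset.sum_congr rfl fun m _ => ?_
  rw [← Real.rpow_natCast, ← Real.rpow_mul hρ.le]
  congr 1
  ring

theorem tsum_pow_mul_abs_cdfDiff_le {ρ : ℝ} (hρ : 0 < ρ) {x y : ℕ → ℝ} (hx : x ∈ probVectors)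
    (hy : y ∈ probVectors) :
    ∑' j, ENNReal.ofReal ((ρ ^ (-(1 / 2) : ℝ)) ^ j * |cdfDiff x y (j + 1)|) ≤
      weightedDist ρ x y := by
  have hq : 0 < ρ ^ (-(1 / 2) : ℝ) := Real.rpow_pos_of_pos hρ _
  set q := ρ ^ (-(1 / 2) : ℝ) with hqdef
  calc ∑' j, ENNReal.ofReal (q ^ j * |cdfDiff x y (j + 1)|)
      ≤ ∑' j, ENNReal.ofReal (q ^ j) * ∑' i, ENNReal.ofReal |x (i + j + 1) - y (i + j + 1)| := by
        refine ENNReal.tsum_le_tsum fun j => ?_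
        rw [ENNReal.ofReal_mul (by positivity)]
        gcongr
        exact ofReal_abs_cdfDiff_le hx hy (j + 1)
    _ = weightedDist ρ x y := by
        rw [tsum_mul_tsum_nat_add (fun j => ENNReal.ofReal (q ^ j))
          fun i => ENNReal.ofReal |x (i + 1) - y (i + 1)|]
        refine tsum_congr fun i => ?_
        rw [weight_eq_sum_pow hρ, ← hqdef,
          ENNReal.ofReal_mul (Finset.sum_nonneg fun _ _ => by positivity),
          ENNReal.ofReal_sum_of_nonneg fun _ _ => by positivity]

/-! ### Decay of the weighted distance and conclusion. -/

theorem geomRate_eq_neg_alphaDot {ρ : ℝ} (hρ : 0 < ρ) (a b : ℝ → ℝ) (u : ℝ) :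
    geomRate a b (ρ ^ (-(1 / 2) : ℝ)) u = -alphaDot ρ a b u := by
  have h : ρ ^ (1 / 2 : ℝ) ≠ 0 := (Real.rpow_pos_of_pos hρ _).ne'
  rw [geomRate, alphaDot, Real.rpow_neg hρ.le, inv_inv]
  field_simp
  ring

theorem tsum_pow_mul_abs_cdfDiff_le_exp_mul {a b : ℝ → ℝ} {s t : ℝ} (hst : s ≤ t)
    (ha : IntervalIntegrable a volume s t) (hb : IntervalIntegrable b volume s t)
    (ha0 : ∀ u ∈ Icc s t, 0 ≤ a u) (hb0 : ∀ u ∈ Icc s t, 0 ≤ b u) {p₁ p₂ : ℝ → ℕ → ℝ}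
    (hp₁ : IsStateProbability (arrivalRate a) (serviceRate b) s p₁)
    (hp₂ : IsStateProbability (arrivalRate a) (serviceRate b) s p₂) {q : ℝ} (hq : 1 < q) :
    ∑' j, ENNReal.ofReal (q ^ j * |cdfDiff (p₁ t) (p₂ t) (j + 1)|) ≤
      ENNReal.ofReal (Real.exp (∫ u in s..t, geomRate a b q u)) *
        ∑' j, ENNReal.ofReal (q ^ j * |cdfDiff (p₁ s) (p₂ s) (j + 1)|) := by
  have hq0 : 0 < q := by linarith
  set S := ∑' j, ENNReal.ofReal (q ^ j * |cdfDiff (p₁ s) (p₂ s) (j + 1)|) with hS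
  -- An infinite initial sum makes the bound trivial because the exponential factor is nonzero.
  rcases eq_or_ne S ⊤ with htop | htop
  · rw [htop, ENNReal.mul_top (by simpa using Real.exp_pos _)]
    exact le_top
  have hsum : ∀ (u : ℝ) (n : ℕ),
      ∑ j ∈ Finset.range n, ENNReal.ofReal (q ^ j * |cdfDiff (p₁ u) (p₂ u) (j + 1)|) =
        ENNReal.ofReal (∑ j ∈ Finset.range n, q ^ j * |cdfDiff (p₁ u) (p₂ u) (j + 1)|) :=
    fun u n => (ENNReal.ofReal_sum_of_nonneg fun _ _ => by positivity).symm
  have hmul : ∀ (u : ℝ) (n : ℕ),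
      ∑ j ∈ Finset.range n, q ^ (j + 1) * |cdfDiff (p₁ u) (p₂ u) (j + 1)| =
        q * ∑ j ∈ Finset.range n, q ^ j * |cdfDiff (p₁ u) (p₂ u) (j + 1)| := fun u n => by
    rw [Finset.mul_sum]
    exact Finset.sum_congr rfl fun j _ => by ring
  have hN : ∀ n, ∑ j ∈ Finset.range n, q ^ (j + 1) * |cdfDiff (p₁ s) (p₂ s) (j + 1)| ≤
      q * S.toReal := fun n => by
    rw [hmul]
    gcongr
    rw [← ENNReal.ofReal_le_iff_le_toReal htop, ← hsum]
    exact ENNReal.sum_le_tsum _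
  rw [ENNReal.tsum_eq_iSup_nat]
  refine iSup_le fun K => ?_
  have h := (isTailSubsolution_abs_cdfDiff hst ha0 hb0 hp₁ hp₂).sum_geom_le hst ha hb ha0 hb0 hq hN K
  rw [hmul, mul_left_comm] at h
  rw [hsum, ← ENNReal.ofReal_toReal htop, ← ENNReal.ofReal_mul (Real.exp_pos _).le]
  exact ENNReal.ofReal_le_ofReal (le_of_mul_le_mul_left h hq0)

end MMQueue

theorem mainTheorem7
    (a a₁ a₂ b b₁ b₂ : ℝ → ℝ) (T₁ T₂ : ℝ)
    (ha : MMQueue.IsBasicRate a a₁ a₂ T₁) (hb : MMQueue.IsBasicRate b b₁ b₂ T₂)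
    (am bm ρ : ℝ) (ham : am = MMQueue.periodMean T₁ a₁) (hbm : bm = MMQueue.periodMean T₂ b₁)
    (hρ : ρ = am / bm)
    (ham_pos : 0 < am) (underloaded : am < bm)
    (s : ℝ) (hs : 0 ≤ s) (p₁ p₂ : ℝ → ℕ → ℝ)
    (hp₁ : MMQueue.IsStateProbability (MMQueue.arrivalRate a) (MMQueue.serviceRate b) s p₁)
    (hp₂ : MMQueue.IsStateProbability (MMQueue.arrivalRate a) (MMQueue.serviceRate b) s p₂)
    (t : ℝ) (hst : s ≤ t) :
    MMQueue.l1Dist (p₁ t) (p₂ t) ≤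
      ENNReal.ofReal (4 * Real.exp (-∫ u in s..t, MMQueue.alphaDot ρ a b u)) *
        MMQueue.weightedDist ρ (p₁ s) (p₂ s) := by
  have hρ0 : 0 < ρ := hρ ▸ div_pos ham_pos (ham_pos.trans underloaded)
  have hρ1 : ρ < 1 := hρ ▸ (div_lt_one (ham_pos.trans underloaded)).2 underloaded
  have hint : ∀ f : ℝ → ℝ, LocallyIntegrableOn f (Ici 0) → IntervalIntegrable f volume s t :=
    fun f hf => (intervalIntegrable_iff_integrableOn_Icc_of_le hst).2
      (hf.integrableOn_compact_subset (fun u hu => hs.trans hu.1) isCompact_Icc)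
  have hq : 1 < ρ ^ (-(1 / 2) : ℝ) := Real.one_lt_rpow_of_pos_of_lt_one_of_neg hρ0 hρ1 (by norm_num)
  have hmain := MMQueue.tsum_pow_mul_abs_cdfDiff_le_exp_mul hst (hint a ha.locallyIntegrable)
    (hint b hb.locallyIntegrable) (fun u hu => ha.nonneg u (hs.trans hu.1))
    (fun u hu => hb.nonneg u (hs.trans hu.1)) hp₁ hp₂ hq
  simp only [MMQueue.geomRate_eq_neg_alphaDot hρ0, intervalIntegral.integral_neg] at hmain
  have hinit := MMQueue.tsum_pow_mul_abs_cdfDiff_le hρ0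
    (hp₁.mem_probVectors s le_rfl) (hp₂.mem_probVectors s le_rfl)
  calc MMQueue.l1Dist (p₁ t) (p₂ t)
      ≤ 2 * ∑' j, ENNReal.ofReal |MMQueue.cdfDiff (p₁ t) (p₂ t) (j + 1)| :=
        MMQueue.l1Dist_le_two_mul_tsum_abs_cdfDiff _ _
    _ ≤ 4 * ∑' j, ENNReal.ofReal
          ((ρ ^ (-(1 / 2) : ℝ)) ^ j * |MMQueue.cdfDiff (p₁ t) (p₂ t) (j + 1)|) := by
        -- The slack 2 ≤ 4 is spent here, and the weights q^j ≥ 1 are inserted.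
        refine mul_le_mul' (by norm_num) (ENNReal.tsum_le_tsum fun j => ?_)
        exact ENNReal.ofReal_le_ofReal
          (le_mul_of_one_le_left (abs_nonneg _) (one_le_pow₀ hq.le))
    _ ≤ 4 * (ENNReal.ofReal (Real.exp (-∫ u in s..t, MMQueue.alphaDot ρ a b u)) *
          MMQueue.weightedDist ρ (p₁ s) (p₂ s)) := by
        gcongr
        exact hmain.trans (by gcongr)
    _ = _ := by
        rw [ENNReal.ofReal_mul (by norm_num), mul_assoc]
        norm_num
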